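/- **Setting.** Let $d,\nu\ge 1$. Tokens are the elements of $[D]=\{1,\dots,D\}$, and a document of length $T$ is $x=(x_1,\dots,x_T)\in[D]^T$. Write $t\in x$ for the positions $\nu<t<T-\nu$. Fix a matrix $R\in\mathbb R^{D\times d}$ and one of the three doc2vec models, each of which attaches to $t\in x$ a vector $\pi_t\in\mathbb R^D$: - PVDMmean: $\pi_t=RPh_t$ with $P\in\mathbb R^{d\times D}$ and $h_t=\frac1{2\nu}\sum_{0<|s-t|\le\nu}\mathbb 1_{x_s}$ ($\mathbb 1_j$ is the $j$-th basis vector of $\mathbb R^D$); - PVDMconcat: $\pi_t=RPh_t$ with $P\in\mathbb R^{d\times 2\nu D}$ and $h_t=[\mathbb 1_{x_{t-\nu}};\dots;\mathbb 1_{x_{t-1}};\mathbb 1_{x_{t+1}};\dots;\mathbb 1_{x_{t+\nu}}]$; - PVDBOW: $\pi_t=0$. Let $\sigma$ be the softmax on $\mathbb R^D$, $\psi_j=-\log\sigma_j$, and $$F_x(q)=\frac1T\sum_{t\in x}\psi_{x_t}(\pi_t+Rq),\qquad q\in\mathbb R^d .$$ For $\alpha>0$ the doc2vec embedding of $x$ is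 the minimizer over $\mathbb R^d$ of $F_x+\frac\alpha2\|\cdot\|^2$ (Euclidean norm). For $x,\tilde x\in[D]^T$ and $\mu\in[0,1]$ put $\Psi(\mu,q)=(1-\mu)F_x(q)+\mu F_{\tilde x}(q)$, and let $q(\mu)$ be the minimizer of $\Psi(\mu,\cdot)+\frac\alpha2\|\cdot\|^2$. For $\mathcal S\subseteq[T]$ let $B(x,\mathcal S)=\{\tilde x\in[D]^T:\ x_i=\tilde x_i\text{ for }i\notin\mathcal S\}$. **Assumption.** The smallest singular value satisfies $\sigma_{\min}(R)>0$, and $\operatorname{range}(R)\subset\mathbb 1^\perp$, where $\mathbb 1=(1,\dots,1)^\top$. **Constants.** With $\ell=3$ and $\Pi=2\nu\,\sigma_{\max}(R)\max_i\|P_{:,i}\|$ ($\Pi=0$ for PVDBOW), let $$A=4\ell\nu D\,e^{2\sqrt2\Pi}\frac{\sigma_{\max}(R)}{\sigma_{\min}(R)^2},\qquad B=64\,\ell\nu D\,\frac{\sigma_{\max}(R)^2}{\sigma_{\min}(R)^2}\,e^{10\sqrt2\Pi}\Big(\frac{\sigma_{\max}(R)^2}{\sigma_{\min}(R)^2}+\frac{\Pi}{D-1}\Big),\qquad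 C=5\sqrt2\,\sigma_{\max}(R),$$ $$c=\frac1{2B}\exp\!\Big(-2(AC+1)\,e^{C\sqrt2\,\sigma_{\max}(R)/\alpha}\Big),\qquad L(r)=2A\,e^{Cr}\quad(r\in\mathbb R).$$ **Theorem.** Under the assumption, $c>0$ and $L(r)>0$ for all $r$, and the following hold. 1. For all $T$, all $x,\tilde x\in[D]^T$ and all $\mu\in[0,1]$ the minimizer $q(\mu)$ exists and is unique. The map $\mu\mapsto q(\mu)$ is differentiable on $[0,1]$, and it is the unique solution on $[0,1]$, starting at the embedding of $x$, of $$\big(\nabla^2\Psi(\mu,q(\mu))+\alpha I\big)\,q'(\mu)+\partial_\mu\nabla\Psi(\mu,q(\mu))=0 .$$ 2. For all $T$, $x\in[D]^T$, $\mathcal S\subseteq[T]$ and $\tilde x\in B(x,\mathcal S)$ with $|\mathcal S|/T\le c$, $$\sup_{\mu\in[0,1]}\|q(\mu)-q(0)\|\le L(\|q(0)\|)\,\frac{|\mathcal S|}{T}.$$ 3. Consequently the embedding is Lipschitz in the Hamming distance $d_H$, with a constant proportional to $1/T$. If $x,\tilde x\in[D]^T$ have embeddings $p,\tilde p$ and $d_H(x,\tilde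 x)/T\le c$, then $\|p-\tilde p\|\le\frac{L(\|p\|)}{T}\,d_H(x,\tilde x)$. Moreover there is a constant $K$, depending only on the model, $P,R,\nu,D$ and $\alpha$, such that $\|p-\tilde p\|\le\frac KT\,d_H(x,\tilde x)$ for all $T$ and all $x,\tilde x\in[D]^T$ with embeddings $p,\tilde p$. -/

import Mathlib

noncomputable section

namespace Doc2Vec

/-- `ℝⁿ` with the Euclidean norm. -/
abbrev Vec (n : ℕ) := EuclideanSpace ℝ (Fin n)

/-- Documents of length `T` over the dictionary `{1, …, D}`. -/
abbrev Doc (D T : ℕ) := Fin T → Fin D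

/-- The documents that agree with `x` outside of the set of positions `S`. -/
def ball {D T : ℕ} (x : Doc D T) (S : Finset (Fin T)) : Set (Doc D T) :=
  {y | ∀ i, i ∉ S → x i = y i}

/-! ### The three models

The positions `t` of a document that are predicted are (with 1-based positions)
`ν < t < T - ν`, that is `t = ν + 1, …, T - ν - 1`. They are indexed here by
`i : Fin (T - (2 * ν + 1))`, with `t = ν + 1 + i`. -/

/-- The predicted position number `i` (0-based position `i + ν`). -/
def center {T : ℕ} (ν : ℕ) (i : Fin (T - (2 * ν + 1))) : Fin T :=
  ⟨i + ν, by have := i.isLt; omega⟩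

/-- The `k`-th entry of the neighborhood `(t-ν, …, t-1, t+1, …, t+ν)` of the predicted
position `t` number `i`. -/
def neighbor {T ν : ℕ} (i : Fin (T - (2 * ν + 1))) (k : Fin (2 * ν)) : Fin T :=
  if (k : ℕ) < ν then ⟨i + k, by have := i.isLt; have := k.isLt; omega⟩
  else ⟨i + k + 1, by have := i.isLt; have := k.isLt; omega⟩

/-- A model (`ν` is the context size), with its frozen projection matrix `P`:
`PVDMmean` with `P` of size `d × D`, `PVDMconcat` with `P` of size `d × 2νD`
(whose columns are indexed by pairs (place in the context, token)), and `PVDBOW`, without `P`. -/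
inductive Model (d D ν : ℕ) where
  | mean (P : Matrix (Fin d) (Fin D) ℝ)
  | concat (P : Matrix (Fin d) (Fin (2 * ν) × Fin D) ℝ)
  | bow

variable {d D ν T : ℕ}

/-- The local information `h_t` for `PVDMmean`: the mean of the one-hot vectors of the context. -/
def meanContext (ν : ℕ) (x : Doc D T) (i : Fin (T - (2 * ν + 1))) : Vec D :=
  ((1 : ℝ) / (2 * (ν : ℝ))) •
    ∑ k : Fin (2 * ν), EuclideanSpace.single (x (neighbor i k)) (1 : ℝ)

/-- The local information `h_t` for `PVDMconcat`: the concatenation of the one-hot vectors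
of the context. -/
def concatContext (ν : ℕ) (x : Doc D T) (i : Fin (T - (2 * ν + 1))) :
    EuclideanSpace ℝ (Fin (2 * ν) × Fin D) :=
  WithLp.toLp 2 fun kj => if x (neighbor i kj.1) = kj.2 then 1 else 0

/-- The projected local information `P h_t` (zero for `PVDBOW`). -/
def Model.context (M : Model d D ν) (x : Doc D T) (i : Fin (T - (2 * ν + 1))) : Vec d :=
  match M with
  | .mean P => Matrix.toEuclideanLin P (meanContext ν x i)
  | .concat P => Matrix.toEuclideanLin P (concatContext ν x i)
  | .bow => 0

/-- The largest Euclidean norm of a column of `P` (zero for `PVDBOW`, which has no `P`). -/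
def Model.maxColNorm (M : Model d D ν) : ℝ :=
  match M with
  | .mean P => ⨆ j : Fin D, ‖(WithLp.toLp 2 (fun i => P i j) : Vec d)‖
  | .concat P => ⨆ j : Fin (2 * ν) × Fin D, ‖(WithLp.toLp 2 (fun i => P i j) : Vec d)‖
  | .bow => 0

/-! ### Objectives -/

/-- The softmax function. -/
def softmax (u : Vec D) : Vec D :=
  WithLp.toLp 2 fun j => Real.exp (u j) / ∑ k, Real.exp (u k)

/-- `ψ_j = - log σ_j`, the cross-entropy loss for the token `j`. -/
def crossEntropy (j : Fin D) (u : Vec D) : ℝ := -Real.log (softmax u j)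

/-- The logits `y_t = R (P h_t + q)`. -/
def logits (M : Model d D ν) (R : Matrix (Fin D) (Fin d) ℝ) (x : Doc D T)
    (i : Fin (T - (2 * ν + 1))) (q : Vec d) : Vec D :=
  Matrix.toEuclideanLin R (M.context x i + q)

/-- The inference objective `q ↦ (1/T) ∑_t ψ_{x_t}(y_t)` of the document `x`. -/
def objective (M : Model d D ν) (R : Matrix (Fin D) (Fin d) ℝ) (x : Doc D T) (q : Vec d) : ℝ :=
  (1 / (T : ℝ)) * ∑ i : Fin (T - (2 * ν + 1)), crossEntropy (x (center ν i)) (logits M R x i q)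

/-- Linear interpolation between the objectives of `x` and of `y`. -/
def interp (M : Model d D ν) (R : Matrix (Fin D) (Fin d) ℝ) (x y : Doc D T) (μ : ℝ)
    (q : Vec d) : ℝ :=
  (1 - μ) * objective M R x q + μ * objective M R y q

/-- `q` minimizes `f + (α/2) ‖·‖²` over `ℝᵈ`. -/
def IsRegMin (α : ℝ) (f : Vec d → ℝ) (q : Vec d) : Prop :=
  IsMinOn (fun p => f p + α / 2 * ‖p‖ ^ 2) Set.univ q

/-- `q` is the doc2vec embedding of `x`: the minimizer of the regularized inference problem. -/
def IsEmbedding (M : Model d D ν) (R : Matrix (Fin D) (Fin d) ℝ) (α : ℝ) (x : Doc D T)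
    (q : Vec d) : Prop :=
  IsRegMin α (objective M R x) q

/-- `q` is differentiable on `[0,1]` and solves there
`(∇²Ψ(μ, q(μ)) + α I) q'(μ) + ∂_μ ∇Ψ(μ, q(μ)) = 0`. -/
def SolvesODE (α : ℝ) (Ψ : ℝ → Vec d → ℝ) (q : ℝ → Vec d) : Prop :=
  ∃ q' : ℝ → Vec d, ∀ μ ∈ Set.Icc (0 : ℝ) 1,
    HasDerivWithinAt q (q' μ) (Set.Icc 0 1) μ ∧
    fderiv ℝ (gradient (Ψ μ)) (q μ) (q' μ) + α • q' μ
      + deriv (fun s => gradient (Ψ s) (q μ)) μ = 0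

/-! ### Constants -/

/-- The all-ones vector. -/
def ones (D : ℕ) : Vec D := WithLp.toLp 2 fun _ => 1

/-- The largest singular value. -/
def sigmaMax (R : Matrix (Fin D) (Fin d) ℝ) : ℝ :=
  (Matrix.toEuclideanLin R).singularValues 0

/-- The smallest of the `d` singular values (sorted decreasingly, indexed from `0`). -/
def sigmaMin (R : Matrix (Fin D) (Fin d) ℝ) : ℝ :=
  (Matrix.toEuclideanLin R).singularValues (d - 1)

/-- `Π = 2ν σ_max(R) max_i ‖P_{:,i}‖`. -/
def constPi (M : Model d D ν) (R : Matrix (Fin D) (Fin d) ℝ) : ℝ :=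
  2 * (ν : ℝ) * sigmaMax R * M.maxColNorm

/-- The numerical constant `ℓ` such that at most `ℓ ν |S|` positions lie within distance `ν` of
`S`, for all `ν ≥ 1`: there are at most `(2ν+1) |S|` of them, so that `ℓ = 3` is the sharp value. -/
def ell : ℝ := 3

/-- `A = 4 ℓ ν D e^{2√2 Π} σ_max / σ_min²`. -/
def constA (M : Model d D ν) (R : Matrix (Fin D) (Fin d) ℝ) : ℝ :=
  4 * ell * (ν : ℝ) * (D : ℝ) * Real.exp (2 * √2 * constPi M R) * (sigmaMax R / sigmaMin R ^ 2)

/-- `B = 64 ℓ ν D (σ_max² / σ_min²) e^{10√2 Π} (σ_max² / σ_min² + Π / (D - 1))`. -/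
def constB (M : Model d D ν) (R : Matrix (Fin D) (Fin d) ℝ) : ℝ :=
  64 * ell * (ν : ℝ) * (D : ℝ) * (sigmaMax R ^ 2 / sigmaMin R ^ 2)
    * Real.exp (10 * √2 * constPi M R)
    * (sigmaMax R ^ 2 / sigmaMin R ^ 2 + constPi M R / ((D : ℝ) - 1))

/-- `C = 5√2 σ_max`. -/
def constC (R : Matrix (Fin D) (Fin d) ℝ) : ℝ := 5 * √2 * sigmaMax R

/-- The threshold `c(α) = (1 / (2B)) exp(-2 (AC + 1) exp(C √2 σ_max / α))` for `|S| / T`. -/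
def threshold (M : Model d D ν) (R : Matrix (Fin D) (Fin d) ℝ) (α : ℝ) : ℝ :=
  1 / (2 * constB M R) *
    Real.exp (-2 * (constA M R * constC R + 1) *
      Real.exp (constC R * (√2 * sigmaMax R / α)))

/-- The Lipschitz constant `L(r) = 2 A e^{C r}`, where `r` is the norm of the embedding. -/
def lipConst (M : Model d D ν) (R : Matrix (Fin D) (Fin d) ℝ) (r : ℝ) : ℝ :=
  2 * constA M R * Real.exp (constC R * r)

end Doc2Vec

end

noncomputable section

namespace Doc2Vec

open scoped RealInnerProductSpace Topology
open Set

/-! ### Monotone vector fields -/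

section Monotone

variable {E : Type*} [NormedAddCommGroup E] [InnerProductSpace ℝ E]

/-! The Hessian of each objective is an average of softmax covariances pulled back by `R`, so `∇F_x`
is a monotone field, and `q(μ)` is the unique zero of the `α`-strongly monotone field `(1 - μ) ∇F_x
+ μ ∇F_y + α id`, which is affine in `μ`. Existence comes from coercivity. Strong monotonicity makes
the zeros Lipschitz in `μ`, and linearizing then gives the ODE. Conversely the ODE says that the
field is constant along the curve, so a solution starting at a zero consists of zeros
(`forall_isRegMin_iff_solvesODE`).

For the bound without `α` in `L`, two estimates compete. Changing the tokens in `S` affects at most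
`3ν|S|` summands of the gradient (`norm_gradObjective_sub_le`). On a ball around `q(0)` the softmax
weights are bounded below, and `range R ⊂ 1^⊥` turns this into strong convexity with an explicit
modulus `k` (`le_inner_hessObjective`). If the perturbation of the gradient at `q(0)` is less than
`kρ`, monotonicity keeps every `q(μ)` within `ρ` of `q(0)` (`norm_sub_le_of_norm_sub_lt`). The
constants are such that `ρ = L(‖q(0)‖)|S|/T` works below the threshold. The global constant `K` uses
only the modulus `α`. -/

theorem le_inner_sub_of_le_inner_fderiv {f : E → E} {f' : E → E →L[ℝ] E}
    (hf : ∀ q, HasFDerivAt f (f' q) q) (p v : E) {a b c : ℝ} (hab : a ≤ b)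
    (hc : ∀ t ∈ Icc a b, c ≤ ⟪f' (p + t • v) v, v⟫) :
    c * (b - a) ≤ ⟪f (p + b • v) - f (p + a • v), v⟫ := by
  have hline : ∀ t : ℝ, HasDerivAt (fun t : ℝ => p + t • v) v t := fun t => by
    simpa using ((hasDerivAt_id t).smul_const v).const_add p
  have hder : ∀ t : ℝ, HasDerivAt (fun t : ℝ => ⟪f (p + t • v), v⟫) ⟪f' (p + t • v) v, v⟫ t := by
    intro t
    have h := ((hf (p + t • v)).comp_hasDerivAt t (hline t)).inner ℝ (hasDerivAt_const t v)
    simpa using h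
  have h := (convex_Icc a b).mul_sub_le_image_sub_of_le_deriv (C := c)
    (fun t _ => (hder t).continuousAt.continuousWithinAt)
    (fun t _ => (hder t).differentiableAt.differentiableWithinAt)
    (fun t ht => by
      rw [(hder t).deriv]
      exact hc t (interior_subset ht))
    a (left_mem_Icc.2 hab) b (right_mem_Icc.2 hab) hab
  simpa [inner_sub_left] using h

theorem mul_norm_sub_le_norm_sub {f : E → E} {f' : E → E →L[ℝ] E}
    (hf : ∀ q, HasFDerivAt f (f' q) q) {k : ℝ} (hk : ∀ q v, k * ‖v‖ ^ 2 ≤ ⟪f' q v, v⟫) (p q : E) :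
    k * ‖q - p‖ ≤ ‖f q - f p‖ := by
  have h := le_inner_sub_of_le_inner_fderiv hf p (q - p) zero_le_one (fun t _ => hk _ (q - p))
  simp only [one_smul, zero_smul, add_zero, add_sub_cancel, sub_zero, mul_one] at h
  have h2 := h.trans (real_inner_le_norm _ _)
  rcases eq_or_ne (‖q - p‖) 0 with h0 | h0
  · simp [h0]
  · have hpos : 0 < ‖q - p‖ := lt_of_le_of_ne (norm_nonneg _) h0.symm
    nlinarith

/-- If a monotone field is strongly monotone on a ball, then a point outside of the ball has a
value which is far from the value at the center. -/
theorem norm_sub_le_of_norm_sub_lt {f : E → E} {f' : E → E →L[ℝ] E}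
    (hf : ∀ q, HasFDerivAt f (f' q) q) (hmono : ∀ q v, 0 ≤ ⟪f' q v, v⟫) {p q : E} {k ρ : ℝ}
    (hρ : 0 ≤ ρ) (hk : ∀ z, ‖z - p‖ ≤ ρ → ∀ v, k * ‖v‖ ^ 2 ≤ ⟪f' z v, v⟫)
    (hlt : ‖f q - f p‖ < k * ρ) : ‖q - p‖ ≤ ρ := by
  by_contra! hr
  have hpos : 0 < ‖q - p‖ := hρ.trans_lt hr
  -- The segment from `p` to `q` leaves the ball at parameter `t`. Up to `t` the field gains `kρ‖q -
  -- p‖` against `q - p`, and beyond `t` monotonicity prevents any loss.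
  set t := ρ / ‖q - p‖ with ht
  have ht0 : 0 ≤ t := div_nonneg hρ hpos.le
  have ht1 : t ≤ 1 := (div_le_one hpos).2 hr.le
  have htr : t * ‖q - p‖ = ρ := div_mul_cancel₀ _ hpos.ne'
  have h1 := le_inner_sub_of_le_inner_fderiv hf p (q - p) ht0 (c := k * ‖q - p‖ ^ 2) (by
    intro s hs
    apply hk
    rw [add_sub_cancel_left, norm_smul, Real.norm_of_nonneg hs.1, ← htr]
    exact mul_le_mul_of_nonneg_right hs.2 hpos.le)
  have h2 := le_inner_sub_of_le_inner_fderiv hf p (q - p) ht1 (c := 0) (fun s _ => hmono _ _)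
  have h3 := add_le_add h1 h2
  rw [← inner_add_left] at h3
  simp only [one_smul, zero_smul, add_zero, add_sub_cancel, sub_zero, zero_mul] at h3
  rw [sub_add_sub_cancel'] at h3
  have h4 := h3.trans (real_inner_le_norm _ _)
  have h5 : k * ‖q - p‖ ^ 2 * t = k * ρ * ‖q - p‖ := by rw [← htr]; ring
  rw [h5] at h4
  exact absurd (le_of_mul_le_mul_right h4 hpos) (not_le.2 hlt)

end Monotone

/-! ### Zeros of an affine family of strongly monotone fields -/

section Path

variable {E : Type*} [NormedAddCommGroup E] [InnerProductSpace ℝ E]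

/-- The field `(1 - μ) f + μ g + α id`. -/
def field (α : ℝ) (f g : E → E) (μ : ℝ) (q : E) : E := (1 - μ) • f q + μ • g q + α • q

/-- The derivative of `field α f g μ`. -/
def fieldDeriv (α : ℝ) (f' g' : E → E →L[ℝ] E) (μ : ℝ) (q : E) : E →L[ℝ] E :=
  (1 - μ) • f' q + μ • g' q + α • ContinuousLinearMap.id ℝ E

variable {α : ℝ} {f g : E → E} {f' g' : E → E →L[ℝ] E}

theorem hasFDerivAt_field (hf : ∀ q, HasFDerivAt f (f' q) q) (hg : ∀ q, HasFDerivAt g (g' q) q)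
    (μ : ℝ) (q : E) : HasFDerivAt (field α f g μ) (fieldDeriv α f' g' μ q) q :=
  (((hf q).const_smul (1 - μ)).add ((hg q).const_smul μ)).add ((hasFDerivAt_id q).const_smul α)

theorem le_inner_fieldDeriv {μ k : ℝ} (hμ : μ ∈ Icc (0 : ℝ) 1) {q v : E}
    (hf : k * ‖v‖ ^ 2 ≤ ⟪f' q v, v⟫) (hg : k * ‖v‖ ^ 2 ≤ ⟪g' q v, v⟫) :
    (k + α) * ‖v‖ ^ 2 ≤ ⟪fieldDeriv α f' g' μ q v, v⟫ := by
  have h : ⟪fieldDeriv α f' g' μ q v, v⟫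
      = (1 - μ) * ⟪f' q v, v⟫ + μ * ⟪g' q v, v⟫ + α * ‖v‖ ^ 2 := by
    simp [fieldDeriv, inner_add_left, real_inner_smul_left]
  rw [h]
  nlinarith [mul_le_mul_of_nonneg_left hf (sub_nonneg.2 hμ.2), mul_le_mul_of_nonneg_left hg hμ.1]

theorem field_sub_field (s μ : ℝ) (q : E) :
    field α f g s q - field α f g μ q = (s - μ) • (g q - f q) := by
  simp only [field]; module

/-- The field at parameter `s` vanishes at `q` and equals `(s - μ)(g p - f p)` at `p`, so strong
monotonicity compares the two points. The case `s = μ` is uniqueness. -/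
theorem mul_norm_sub_le_of_field_eq_zero
    (hf : ∀ q, HasFDerivAt f (f' q) q) (hg : ∀ q, HasFDerivAt g (g' q) q)
    (hf0 : ∀ q v, 0 ≤ ⟪f' q v, v⟫) (hg0 : ∀ q v, 0 ≤ ⟪g' q v, v⟫)
    {s μ : ℝ} (hs : s ∈ Icc (0 : ℝ) 1) {p q : E}
    (hp : field α f g μ p = 0) (hq : field α f g s q = 0) :
    α * ‖q - p‖ ≤ |s - μ| * ‖g p - f p‖ := by
  have h := mul_norm_sub_le_norm_sub (hasFDerivAt_field (α := α) hf hg s) (k := α)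
    (fun z v => by
      simpa using le_inner_fieldDeriv (α := α) (k := 0) hs (by simpa using hf0 z v)
        (by simpa using hg0 z v)) p q
  rw [hq, ← hp, field_sub_field, norm_smul, Real.norm_eq_abs, abs_sub_comm] at h
  exact h

theorem norm_sub_le_of_field_eq_zero
    (hf : ∀ q, HasFDerivAt f (f' q) q) (hg : ∀ q, HasFDerivAt g (g' q) q)
    (hf0 : ∀ q v, 0 ≤ ⟪f' q v, v⟫) (hg0 : ∀ q v, 0 ≤ ⟪g' q v, v⟫) (hα : 0 < α)
    {μ k ρ : ℝ} (hμ : μ ∈ Icc (0 : ℝ) 1) {p q : E} (hρ : 0 ≤ ρ)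
    (hfk : ∀ z, ‖z - p‖ ≤ ρ → ∀ v, k * ‖v‖ ^ 2 ≤ ⟪f' z v, v⟫)
    (hgk : ∀ z, ‖z - p‖ ≤ ρ → ∀ v, k * ‖v‖ ^ 2 ≤ ⟪g' z v, v⟫)
    (hp : field α f g 0 p = 0) (hq : field α f g μ q = 0) (hlt : ‖g p - f p‖ < k * ρ) :
    ‖q - p‖ ≤ ρ := by
  refine norm_sub_le_of_norm_sub_lt (k := k) (hasFDerivAt_field (α := α) hf hg μ) (fun z v => ?_)
    hρ (fun z hz v => ?_) ?_
  · refine le_trans (by positivity) (le_inner_fieldDeriv (α := α) (k := 0) hμ (by simpa using hf0 z v)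
      (by simpa using hg0 z v))
  · refine le_trans ?_ (le_inner_fieldDeriv (α := α) hμ (hfk z hz v) (hgk z hz v))
    -- The contribution of `α` is dropped, so that the radius depends only on the convexity of the
    -- objectives.
    nlinarith [mul_nonneg hα.le (sq_nonneg ‖v‖)]
  · rw [hq, ← hp, ← norm_neg, neg_sub, field_sub_field, norm_smul, Real.norm_eq_abs, sub_zero,
      abs_of_nonneg hμ.1]
    exact (mul_le_of_le_one_left (norm_nonneg _) hμ.2).trans_lt hlt

/-- An implicit function argument done by hand, since the zeros are only given for `μ ∈ [0,1]` and
the derivative is one-sided at the endpoints. Coercivity makes `H` invertible and the candidate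
derivative is `-H⁻¹ b`. -/
theorem hasDerivWithinAt_of_field_eq_zero [FiniteDimensional ℝ E]
    (hf : ∀ q, HasFDerivAt f (f' q) q) (hg : ∀ q, HasFDerivAt g (g' q) q)
    (hf0 : ∀ q v, 0 ≤ ⟪f' q v, v⟫) (hg0 : ∀ q v, 0 ≤ ⟪g' q v, v⟫) (hα : 0 < α) {q : ℝ → E}
    (hq : ∀ μ ∈ Icc (0 : ℝ) 1, field α f g μ (q μ) = 0) {μ : ℝ} (hμ : μ ∈ Icc (0 : ℝ) 1) :
    ∃ v, HasDerivWithinAt q v (Icc 0 1) μ ∧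
      fieldDeriv α f' g' μ (q μ) v + (g (q μ) - f (q μ)) = 0 := by
  set H := fieldDeriv α f' g' μ (q μ) with hH
  set b := g (q μ) - f (q μ) with hb
  have hcoer : ∀ v, α * ‖v‖ ^ 2 ≤ ⟪H v, v⟫ := fun v => by
    simpa using le_inner_fieldDeriv (α := α) (k := 0) hμ (by simpa using hf0 (q μ) v)
      (by simpa using hg0 (q μ) v)
  have hlow : ∀ v, α * ‖v‖ ≤ ‖H v‖ := fun v => by
    simpa using mul_norm_sub_le_norm_sub (fun z => H.hasFDerivAt (x := z))
      (fun _ v => hcoer v) 0 v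
  have hinj : Function.Injective (H : E →ₗ[ℝ] E) := by
    rw [← LinearMap.ker_eq_bot, LinearMap.ker_eq_bot']
    intro v hv
    have := hlow v
    rw [show H v = 0 from hv, norm_zero] at this
    exact norm_eq_zero.1 (le_antisymm (by nlinarith) (norm_nonneg v))
  obtain ⟨v, hv⟩ := LinearMap.surjective_of_injective hinj (-b)
  have hv : H v = -b := hv
  refine ⟨v, ?_, by rw [hv]; simp⟩
  have hlip : ∀ s ∈ Icc (0 : ℝ) 1, ‖q s - q μ‖ ≤ α⁻¹ * ‖b‖ * ‖s - μ‖ := fun s hs => by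
    have h := mul_norm_sub_le_of_field_eq_zero hf hg hf0 hg0 hs (hq μ hμ) (hq s hs)
    rw [Real.norm_eq_abs, mul_assoc, ← mul_le_mul_iff_right₀ hα, mul_inv_cancel_left₀ hα.ne',
      mul_comm ‖b‖]
    exact h
  have hO : (fun s => q s - q μ) =O[𝓝[Icc 0 1] μ] fun s => s - μ :=
    Asymptotics.IsBigO.of_bound _ (eventually_nhdsWithin_of_forall hlip)
  have hcont : Filter.Tendsto q (𝓝[Icc 0 1] μ) (𝓝 (q μ)) := by
    rw [tendsto_iff_norm_sub_tendsto_zero]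
    refine squeeze_zero' (Filter.Eventually.of_forall fun _ => norm_nonneg _)
      (eventually_nhdsWithin_of_forall hlip) ?_
    have : Continuous fun s : ℝ => α⁻¹ * ‖b‖ * ‖s - μ‖ := by fun_prop
    simpa using (this.tendsto μ).mono_left nhdsWithin_le_nhds
  -- The Lipschitz bound turns an error `o(q s - q μ)` into `o(s - μ)`.
  have h1 : (fun s => field α f g μ (q s) - field α f g μ (q μ) - H (q s - q μ))
      =o[𝓝[Icc 0 1] μ] fun s => s - μ :=
    (((hasFDerivAt_field hf hg μ (q μ)).isLittleO).comp_tendsto hcont).trans_isBigO hO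
  have h2 : (fun s => (s - μ) • ((g (q s) - f (q s)) - b)) =o[𝓝[Icc 0 1] μ] fun s => s - μ := by
    have hc : Filter.Tendsto (fun s => (g (q s) - f (q s)) - b) (𝓝[Icc 0 1] μ) (𝓝 0) := by
      have := (((hg (q μ)).continuousAt.sub (hf (q μ)).continuousAt).tendsto.comp hcont).sub_const b
      simpa [hb] using this
    have := (Asymptotics.isBigO_refl (fun s : ℝ => s - μ) (𝓝[Icc 0 1] μ)).smul_isLittleO
      ((Asymptotics.isLittleO_one_iff ℝ).2 hc)
    simpa using this
  have h3 : (fun s => H (q s - q μ - (s - μ) • v)) =o[𝓝[Icc 0 1] μ] fun s => s - μ := by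
    refine (h1.add h2).neg_left.congr' (eventually_nhdsWithin_of_forall fun s hs => ?_)
      Filter.EventuallyEq.rfl
    have e := field_sub_field (α := α) (f := f) (g := g) s μ (q s)
    rw [hq s hs, zero_sub] at e
    simp only [map_sub, map_smul, hv, hq μ hμ, smul_sub, smul_neg]
    rw [smul_sub] at e
    rw [neg_eq_iff_eq_neg.1 e]
    abel
  rw [hasDerivWithinAt_iff_isLittleO]
  -- `‖H v‖ ≥ α‖v‖` removes `H` from the estimate `h3`.
  refine Asymptotics.IsBigO.trans_isLittleO (Asymptotics.IsBigO.of_bound α⁻¹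
    (Filter.Eventually.of_forall fun s => ?_)) h3
  rw [← mul_le_mul_iff_right₀ hα, mul_inv_cancel_left₀ hα.ne']
  exact hlow _

/-- The left side of the ODE is the total derivative of `μ ↦ field α f g μ (q μ)`, which is
therefore constant. Uniqueness for the ODE thus follows from uniqueness of zeros, without Lipschitz
estimates on the Hessian. -/
theorem field_eq_zero_of_hasDerivWithinAt
    (hf : ∀ q, HasFDerivAt f (f' q) q) (hg : ∀ q, HasFDerivAt g (g' q) q) {q q' : ℝ → E}
    (hq : ∀ μ ∈ Icc (0 : ℝ) 1, HasDerivWithinAt q (q' μ) (Icc 0 1) μ)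
    (hode : ∀ μ ∈ Icc (0 : ℝ) 1,
      fieldDeriv α f' g' μ (q μ) (q' μ) + (g (q μ) - f (q μ)) = 0)
    (h0 : field α f g 0 (q 0) = 0) {μ : ℝ} (hμ : μ ∈ Icc (0 : ℝ) 1) :
    field α f g μ (q μ) = 0 := by
  have hder : ∀ s ∈ Icc (0 : ℝ) 1,
      HasDerivWithinAt (fun s => field α f g s (q s)) 0 (Icc 0 1) s := by
    intro s hs
    have hid := hasDerivWithinAt_id s (Icc (0 : ℝ) 1)
    have h1 := (hid.const_sub 1).smul ((hf (q s)).comp_hasDerivWithinAt s (hq s hs))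
    have h2 := hid.smul ((hg (q s)).comp_hasDerivWithinAt s (hq s hs))
    have h3 := (hq s hs).const_smul α
    refine ((h1.add h2).add h3).congr_deriv ?_
    rw [← hode s hs]
    simp [fieldDeriv]
    module
  have := constant_of_derivWithin_zero (f := fun s => field α f g s (q s))
    (fun s hs => (hder s hs).differentiableWithinAt)
    (fun s hs => (hder s ⟨hs.1, hs.2.le⟩).derivWithin
      (uniqueDiffOn_Icc zero_lt_one s ⟨hs.1, hs.2.le⟩)) μ hμ
  rw [this, h0]

end Path

/-! ### Singular values -/

section Singular

variable {E F : Type*} [NormedAddCommGroup E] [InnerProductSpace ℝ E] [FiniteDimensional ℝ E]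
  [NormedAddCommGroup F] [InnerProductSpace ℝ F] [FiniteDimensional ℝ F] (f : E →ₗ[ℝ] F)

/-- `‖f v‖² = ⟪f*f v, v⟫`, diagonalized in an eigenbasis of `f*f`; both extremal singular value
bounds are read off from it. -/
theorem norm_sq_eq_sum_singularValues {n : ℕ} (hn : Module.finrank ℝ E = n) (v : E) :
    ‖f v‖ ^ 2 = ∑ i : Fin n, f.singularValues i ^ 2
      * ((f.isSymmetric_adjoint_comp_self.eigenvectorBasis hn).repr v i) ^ 2 := by
  have hS := f.isSymmetric_adjoint_comp_self
  set b := hS.eigenvectorBasis hn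
  have h1 : ‖f v‖ ^ 2 = ⟪(LinearMap.adjoint f ∘ₗ f) v, v⟫ := by
    rw [LinearMap.comp_apply, LinearMap.adjoint_inner_left, real_inner_self_eq_norm_sq]
  rw [h1, ← b.repr.inner_map_map, PiLp.inner_apply]
  refine Finset.sum_congr rfl fun i _ => ?_
  rw [hS.eigenvectorBasis_apply_self_apply hn v i, ← f.sq_singularValues_fin hn]
  simp
  ring

theorem norm_sq_eq_sum_repr {n : ℕ} (hn : Module.finrank ℝ E = n) (v : E) :
    ‖v‖ ^ 2 = ∑ i : Fin n,
      ((f.isSymmetric_adjoint_comp_self.eigenvectorBasis hn).repr v i) ^ 2 := by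
  rw [← (f.isSymmetric_adjoint_comp_self.eigenvectorBasis hn).repr.norm_map v,
    EuclideanSpace.real_norm_sq_eq]

theorem norm_le_singularValues_zero (v : E) : ‖f v‖ ≤ f.singularValues 0 * ‖v‖ := by
  refine le_of_sq_le_sq ?_ (mul_nonneg (f.singularValues_nonneg 0) (norm_nonneg v))
  rw [mul_pow, norm_sq_eq_sum_singularValues f rfl, norm_sq_eq_sum_repr f rfl v, Finset.mul_sum]
  refine Finset.sum_le_sum fun i _ => mul_le_mul_of_nonneg_right ?_ (sq_nonneg _)
  exact pow_le_pow_left₀ (f.singularValues_nonneg _) (f.singularValues_antitone (Nat.zero_le _)) 2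

theorem singularValues_mul_norm_le {n : ℕ} (hn : Module.finrank ℝ E = n) (v : E) :
    f.singularValues (n - 1) * ‖v‖ ≤ ‖f v‖ := by
  refine le_of_sq_le_sq ?_ (norm_nonneg _)
  rw [mul_pow, norm_sq_eq_sum_singularValues f hn, norm_sq_eq_sum_repr f hn v, Finset.mul_sum]
  refine Finset.sum_le_sum fun i _ => mul_le_mul_of_nonneg_right ?_ (sq_nonneg _)
  exact pow_le_pow_left₀ (f.singularValues_nonneg _)
    (f.singularValues_antitone (Nat.le_sub_one_of_lt i.isLt)) 2

end Singular

/-! ### Softmax -/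

section Softmax

variable {D : ℕ}

theorem sum_exp_pos [Nonempty (Fin D)] (u : Vec D) : 0 < ∑ k, Real.exp (u k) :=
  Finset.sum_pos (fun _ _ => Real.exp_pos _) Finset.univ_nonempty

theorem softmax_apply (u : Vec D) (j : Fin D) :
    softmax u j = Real.exp (u j) / ∑ k, Real.exp (u k) := rfl

theorem softmax_pos [Nonempty (Fin D)] (u : Vec D) (j : Fin D) : 0 < softmax u j :=
  div_pos (Real.exp_pos _) (sum_exp_pos u)

theorem sum_softmax [Nonempty (Fin D)] (u : Vec D) : ∑ j, softmax u j = 1 := by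
  simp_rw [softmax_apply, ← Finset.sum_div]
  exact div_self (sum_exp_pos u).ne'

theorem softmax_le_one [Nonempty (Fin D)] (u : Vec D) (j : Fin D) : softmax u j ≤ 1 := by
  rw [← sum_softmax u]
  exact Finset.single_le_sum (fun k _ => (softmax_pos u k).le) (Finset.mem_univ j)

/-- The Jacobian of softmax. -/
def softmaxDeriv (u : Vec D) : Vec D →L[ℝ] Vec D :=
  LinearMap.toContinuousLinearMap
    { toFun := fun v => WithLp.toLp 2 fun j => softmax u j * (v j - ∑ k, softmax u k * v k)
      map_add' := fun v w => by
        ext j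
        simp [mul_add, Finset.sum_add_distrib]
        ring
      map_smul' := fun c v => by
        ext j
        simp [mul_left_comm _ c, ← Finset.mul_sum]
        ring }

theorem softmaxDeriv_apply (u v : Vec D) (j : Fin D) :
    softmaxDeriv u v j = softmax u j * (v j - ∑ k, softmax u k * v k) := rfl

theorem hasFDerivAt_exp_apply (u : Vec D) (j : Fin D) :
    HasFDerivAt (fun u : Vec D => Real.exp (u j))
      (Real.exp (u j) • (EuclideanSpace.proj j : Vec D →L[ℝ] ℝ)) u :=
  ((EuclideanSpace.proj j : Vec D →L[ℝ] ℝ).hasFDerivAt (x := u)).exp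

theorem hasFDerivAt_sum_exp (u : Vec D) :
    HasFDerivAt (fun u : Vec D => ∑ k, Real.exp (u k))
      (∑ k, Real.exp (u k) • (EuclideanSpace.proj k : Vec D →L[ℝ] ℝ)) u :=
  HasFDerivAt.fun_sum fun k _ => hasFDerivAt_exp_apply u k

theorem hasFDerivAt_softmax [Nonempty (Fin D)] (u : Vec D) :
    HasFDerivAt softmax (softmaxDeriv u) u := by
  rw [← hasFDerivWithinAt_univ, hasFDerivWithinAt_euclidean]
  intro j
  rw [hasFDerivWithinAt_univ]
  have hS := (sum_exp_pos u).ne'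
  have h := (hasFDerivAt_exp_apply u j).mul
    ((hasDerivAt_inv hS).comp_hasFDerivAt u (hasFDerivAt_sum_exp u))
  refine h.congr_fderiv ?_
  ext v
  simp [softmaxDeriv_apply, softmax_apply]
  simp_rw [div_mul_eq_mul_div, ← Finset.sum_div]
  field_simp
  ring

theorem crossEntropy_eq [Nonempty (Fin D)] (j : Fin D) (u : Vec D) :
    crossEntropy j u = Real.log (∑ k, Real.exp (u k)) - u j := by
  rw [crossEntropy, softmax_apply, Real.log_div (Real.exp_ne_zero _) (sum_exp_pos u).ne',
    Real.log_exp, neg_sub]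

theorem crossEntropy_nonneg [Nonempty (Fin D)] (j : Fin D) (u : Vec D) : 0 ≤ crossEntropy j u :=
  neg_nonneg.2 (Real.log_nonpos (softmax_pos u j).le (softmax_le_one u j))

theorem hasGradientAt_crossEntropy [Nonempty (Fin D)] (j : Fin D) (u : Vec D) :
    HasGradientAt (crossEntropy j) (softmax u - EuclideanSpace.single j 1) u := by
  rw [hasGradientAt_iff_hasFDerivAt]
  have hS := (sum_exp_pos u).ne'
  have h := ((hasFDerivAt_sum_exp u).log hS).fun_sub
    ((EuclideanSpace.proj j : Vec D →L[ℝ] ℝ).hasFDerivAt (x := u))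
  have e : crossEntropy j = fun u : Vec D => Real.log (∑ k, Real.exp (u k)) - u j :=
    funext (crossEntropy_eq j)
  rw [e]
  refine h.congr_fderiv ?_
  ext v
  simp [PiLp.inner_apply, softmax_apply, Finset.mul_sum]
  refine Finset.sum_congr rfl fun k _ => ?_
  field_simp

theorem norm_softmax_sub_single_le [Nonempty (Fin D)] (u : Vec D) (j : Fin D) :
    ‖softmax u - EuclideanSpace.single j 1‖ ≤ √2 := by
  refine Real.le_sqrt_of_sq_le ?_
  rw [@norm_sub_sq_real]
  have h1 : ‖softmax u‖ ^ 2 ≤ 1 := by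
    rw [EuclideanSpace.real_norm_sq_eq, ← sum_softmax u]
    exact Finset.sum_le_sum fun k _ => by
      nlinarith [softmax_pos u k, softmax_le_one u k]
  have h2 : ⟪softmax u, EuclideanSpace.single j (1 : ℝ)⟫ = softmax u j := by
    simp [EuclideanSpace.inner_single_right]
  rw [h2]
  have := softmax_pos u j
  simp
  linarith

/-- From `(a - b)² ≤ 2(a² + b²)`. This is the source of `√2` in the exponents. -/
theorem apply_sub_apply_le_sqrt_two_mul_norm (u : Vec D) (j k : Fin D) :
    u k - u j ≤ √2 * ‖u‖ := by
  rcases eq_or_ne k j with rfl | hkj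
  · simp
  · have h : u k ^ 2 + u j ^ 2 ≤ ‖u‖ ^ 2 := by
      rw [EuclideanSpace.real_norm_sq_eq, ← Finset.sum_pair (f := fun i => u i ^ 2) hkj]
      exact Finset.sum_le_sum_of_subset_of_nonneg (Finset.subset_univ _) fun _ _ _ => sq_nonneg _
    refine le_of_sq_le_sq ?_ (by positivity)
    rw [mul_pow, Real.sq_sqrt zero_le_two]
    nlinarith [sq_nonneg (u k + u j)]

theorem exp_div_le_softmax [Nonempty (Fin D)] (u : Vec D) (j : Fin D) :
    Real.exp (-(√2 * ‖u‖)) / D ≤ softmax u j := by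
  have hD : (0 : ℝ) < D := by
    have := Fin.pos j
    exact_mod_cast this
  rw [softmax_apply, div_le_div_iff₀ hD (sum_exp_pos u), Finset.mul_sum]
  have : ∑ k, Real.exp (-(√2 * ‖u‖)) * Real.exp (u k) ≤ ∑ _k : Fin D, Real.exp (u j) := by
    refine Finset.sum_le_sum fun k _ => ?_
    rw [← Real.exp_add, Real.exp_le_exp]
    linarith [apply_sub_apply_le_sqrt_two_mul_norm u j k]
  refine this.trans_eq ?_
  simp [mul_comm]

/-- The quadratic form is the variance of `v` under the law `softmax u`. -/
theorem inner_softmaxDeriv [Nonempty (Fin D)] (u v : Vec D) :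
    ⟪softmaxDeriv u v, v⟫ = ∑ j, softmax u j * (v j - ∑ k, softmax u k * v k) ^ 2 := by
  set m := ∑ k, softmax u k * v k with hm
  have h0 : ∑ j, softmax u j * (v j - m) = 0 := by
    simp_rw [mul_sub, Finset.sum_sub_distrib, ← Finset.sum_mul, sum_softmax, one_mul]
    exact sub_self _
  have h1 : ∑ j, softmax u j * (v j - m) ^ 2
      = ∑ j, softmax u j * (v j - m) * v j - (∑ j, softmax u j * (v j - m)) * m := by
    rw [Finset.sum_mul, ← Finset.sum_sub_distrib]
    exact Finset.sum_congr rfl fun _ _ => by ring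
  rw [h1, h0, zero_mul, sub_zero, PiLp.inner_apply]
  refine Finset.sum_congr rfl fun j _ => ?_
  simp [softmaxDeriv_apply, ← hm]
  ring

theorem inner_softmaxDeriv_nonneg [Nonempty (Fin D)] (u v : Vec D) :
    0 ≤ ⟪softmaxDeriv u v, v⟫ := by
  rw [inner_softmaxDeriv]
  exact Finset.sum_nonneg fun j _ => mul_nonneg (softmax_pos u j).le (sq_nonneg _)

theorem le_inner_softmaxDeriv [Nonempty (Fin D)] (u : Vec D) {v : Vec D} (hv : ∑ j, v j = 0) :
    Real.exp (-(√2 * ‖u‖)) / D * ‖v‖ ^ 2 ≤ ⟪softmaxDeriv u v, v⟫ := by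
  rw [inner_softmaxDeriv]
  set m := ∑ k, softmax u k * v k
  set a := Real.exp (-(√2 * ‖u‖)) / D
  have ha : 0 ≤ a := by positivity
  -- As `v ⟂ 1`, subtracting a constant vector can only increase the norm.
  have h1 : ‖v‖ ^ 2 ≤ ∑ j, (v j - m) ^ 2 := by
    have : ∑ j, (v j - m) ^ 2 = ∑ j, v j ^ 2 - 2 * m * ∑ j, v j + D * m ^ 2 := by
      simp_rw [sub_sq, Finset.sum_add_distrib, Finset.sum_sub_distrib, Finset.mul_sum]
      simp
      exact Finset.sum_congr rfl fun _ _ => by ring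
    rw [this, hv, EuclideanSpace.real_norm_sq_eq]
    nlinarith [mul_nonneg (Nat.cast_nonneg (α := ℝ) D) (sq_nonneg m)]
  calc a * ‖v‖ ^ 2 ≤ a * ∑ j, (v j - m) ^ 2 := mul_le_mul_of_nonneg_left h1 ha
    _ = ∑ j, a * (v j - m) ^ 2 := Finset.mul_sum _ _ _
    _ ≤ _ := Finset.sum_le_sum fun j _ =>
      mul_le_mul_of_nonneg_right (exp_div_le_softmax u j) (sq_nonneg _)

end Softmax

/-! ### The objective and its derivatives -/

section Objective

variable {d D ν T : ℕ}

/-- The matrix `R` as a continuous linear map. -/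
def linR (R : Matrix (Fin D) (Fin d) ℝ) : Vec d →L[ℝ] Vec D :=
  LinearMap.toContinuousLinearMap (Matrix.toEuclideanLin R)

theorem sigmaMax_nonneg (R : Matrix (Fin D) (Fin d) ℝ) : 0 ≤ sigmaMax R :=
  LinearMap.singularValues_nonneg _ _

theorem sigmaMin_le_sigmaMax (R : Matrix (Fin D) (Fin d) ℝ) : sigmaMin R ≤ sigmaMax R :=
  LinearMap.singularValues_antitone _ (Nat.zero_le _)

theorem norm_linR_le (R : Matrix (Fin D) (Fin d) ℝ) (v : Vec d) :
    ‖linR R v‖ ≤ sigmaMax R * ‖v‖ :=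
  norm_le_singularValues_zero (Matrix.toEuclideanLin R) v

theorem sigmaMin_mul_norm_le (R : Matrix (Fin D) (Fin d) ℝ) (v : Vec d) :
    sigmaMin R * ‖v‖ ≤ ‖linR R v‖ :=
  singularValues_mul_norm_le (Matrix.toEuclideanLin R) finrank_euclideanSpace_fin v

theorem norm_adjoint_linR_le (R : Matrix (Fin D) (Fin d) ℝ) (w : Vec D) :
    ‖(linR R).adjoint w‖ ≤ sigmaMax R * ‖w‖ := by
  refine ((linR R).adjoint.le_opNorm w).trans (mul_le_mul_of_nonneg_right ?_ (norm_nonneg w))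
  rw [LinearIsometryEquiv.norm_map]
  exact (linR R).opNorm_le_bound (sigmaMax_nonneg R) (norm_linR_le R)

/-- The gradient of the objective. -/
def gradObjective (M : Model d D ν) (R : Matrix (Fin D) (Fin d) ℝ) (x : Doc D T) (q : Vec d) :
    Vec d :=
  (1 / (T : ℝ)) • ∑ i : Fin (T - (2 * ν + 1)),
    (linR R).adjoint (softmax (logits M R x i q) - EuclideanSpace.single (x (center ν i)) 1)

/-- The Hessian of the objective. -/
def hessObjective (M : Model d D ν) (R : Matrix (Fin D) (Fin d) ℝ) (x : Doc D T) (q : Vec d) :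
    Vec d →L[ℝ] Vec d :=
  (1 / (T : ℝ)) • ∑ i : Fin (T - (2 * ν + 1)),
    (linR R).adjoint ∘L softmaxDeriv (logits M R x i q) ∘L linR R

variable (M : Model d D ν) (R : Matrix (Fin D) (Fin d) ℝ)

theorem hasFDerivAt_logits (x : Doc D T) (i : Fin (T - (2 * ν + 1))) (q : Vec d) :
    HasFDerivAt (logits M R x i) (linR R) q :=
  ((linR R).hasFDerivAt.comp q ((hasFDerivAt_id q).const_add (M.context x i)) :)

theorem hasFDerivAt_objective [Nonempty (Fin D)] (x : Doc D T) (q : Vec d) :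
    HasFDerivAt (objective M R x) (innerSL ℝ (gradObjective M R x q)) q := by
  have h := (HasFDerivAt.fun_sum (u := Finset.univ) fun (i : Fin (T - (2 * ν + 1))) _ =>
    (hasGradientAt_iff_hasFDerivAt.1 (hasGradientAt_crossEntropy (x (center ν i))
      (logits M R x i q))).comp q (hasFDerivAt_logits M R x i q)).const_mul (1 / (T : ℝ))
  refine h.congr_fderiv ?_
  ext v
  simp [gradObjective, ContinuousLinearMap.adjoint_inner_left]

theorem hasFDerivAt_gradObjective [Nonempty (Fin D)] (x : Doc D T) (q : Vec d) :
    HasFDerivAt (gradObjective M R x) (hessObjective M R x q) q :=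
  (HasFDerivAt.fun_sum (u := Finset.univ) fun (i : Fin (T - (2 * ν + 1))) _ =>
    (linR R).adjoint.hasFDerivAt.comp q
      (((hasFDerivAt_softmax (logits M R x i q)).comp q
        (hasFDerivAt_logits M R x i q)).sub_const _)).const_smul (1 / (T : ℝ))

theorem hasGradientAt_interp [Nonempty (Fin D)] (x y : Doc D T) (μ : ℝ) (q : Vec d) :
    HasGradientAt (interp M R x y μ) (field 0 (gradObjective M R x) (gradObjective M R y) μ q) q := by
  rw [hasGradientAt_iff_hasFDerivAt]
  refine (((hasFDerivAt_objective M R x q).const_mul (1 - μ)).add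
    ((hasFDerivAt_objective M R y q).const_mul μ)).congr_fderiv ?_
  ext v
  simp [field]

theorem gradient_interp [Nonempty (Fin D)] (x y : Doc D T) (μ : ℝ) :
    gradient (interp M R x y μ) = field 0 (gradObjective M R x) (gradObjective M R y) μ :=
  gradient_eq (hasGradientAt_interp M R x y μ)

theorem inner_hessObjective (x : Doc D T) (q v : Vec d) :
    ⟪hessObjective M R x q v, v⟫ = (1 / (T : ℝ)) * ∑ i : Fin (T - (2 * ν + 1)),
      ⟪softmaxDeriv (logits M R x i q) (linR R v), linR R v⟫ := by
  simp [hessObjective, real_inner_smul_left, sum_inner, ContinuousLinearMap.adjoint_inner_left]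

theorem inner_hessObjective_nonneg [Nonempty (Fin D)] (x : Doc D T) (q v : Vec d) :
    0 ≤ ⟪hessObjective M R x q v, v⟫ := by
  rw [inner_hessObjective]
  exact mul_nonneg (by positivity)
    (Finset.sum_nonneg fun i _ => inner_softmaxDeriv_nonneg _ _)

/-! ### Minimizers -/

theorem interp_zero (x y : Doc D T) : interp M R x y 0 = objective M R x := by
  ext q; simp [interp]

theorem interp_one (x y : Doc D T) : interp M R x y 1 = objective M R y := by
  ext q; simp [interp]

section Minimizers

variable [Nonempty (Fin D)] {α : ℝ}

theorem interp_nonneg (x y : Doc D T) {μ : ℝ} (hμ : μ ∈ Icc (0 : ℝ) 1) (q : Vec d) :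
    0 ≤ interp M R x y μ q := by
  have h : ∀ z : Doc D T, 0 ≤ objective M R z q := fun z =>
    mul_nonneg (by positivity) (Finset.sum_nonneg fun i _ => crossEntropy_nonneg _ _)
  exact add_nonneg (mul_nonneg (sub_nonneg.2 hμ.2) (h x)) (mul_nonneg hμ.1 (h y))

theorem exists_isRegMin (hα : 0 < α) (x y : Doc D T) {μ : ℝ} (hμ : μ ∈ Icc (0 : ℝ) 1) :
    ∃ q, IsRegMin α (interp M R x y μ) q := by
  have hc : Continuous fun p : Vec d => interp M R x y μ p + α / 2 * ‖p‖ ^ 2 :=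
    (continuous_iff_continuousAt.2 fun p =>
      (hasGradientAt_interp M R x y μ p).differentiableAt.continuousAt).add (by fun_prop)
  have ht : Filter.Tendsto (fun p : Vec d => interp M R x y μ p + α / 2 * ‖p‖ ^ 2)
      (Filter.cocompact _) Filter.atTop := by
    refine Filter.tendsto_atTop_mono
      (fun p => le_add_of_nonneg_left (interp_nonneg M R x y hμ p)) ?_
    exact ((Filter.tendsto_pow_atTop two_ne_zero).comp
      (tendsto_norm_cocompact_atTop (E := Vec d))).const_mul_atTop (half_pos hα)
  obtain ⟨q, hq⟩ := hc.exists_forall_le ht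
  exact ⟨q, fun p _ => hq p⟩

theorem field_eq_zero_of_isRegMin (x y : Doc D T) {μ : ℝ} {q : Vec d}
    (hq : IsRegMin α (interp M R x y μ) q) :
    field α (gradObjective M R x) (gradObjective M R y) μ q = 0 := by
  have hder := (hasGradientAt_iff_hasFDerivAt.1 (hasGradientAt_interp M R x y μ q)).add
    ((hasStrictFDerivAt_norm_sq q).hasFDerivAt.const_mul (α / 2))
  have hloc : IsLocalMin (fun p => interp M R x y μ p + α / 2 * ‖p‖ ^ 2) q :=
    hq.isLocalMin Filter.univ_mem
  have h0 := hloc.hasFDerivAt_eq_zero hder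
  refine ext_inner_right ℝ fun v => ?_
  have h1 := DFunLike.congr_fun h0 v
  rw [inner_zero_left]
  refine Eq.trans ?_ h1
  simp [field, inner_add_left, real_inner_smul_left]
  ring

theorem isRegMin_iff_field_eq_zero (hα : 0 < α) (x y : Doc D T) {μ : ℝ} (hμ : μ ∈ Icc (0 : ℝ) 1)
    {q : Vec d} : IsRegMin α (interp M R x y μ) q ↔
      field α (gradObjective M R x) (gradObjective M R y) μ q = 0 := by
  refine ⟨field_eq_zero_of_isRegMin M R x y, fun hq => ?_⟩
  -- No convexity criterion is needed: some minimizer exists, it is a zero, and zeros are unique.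
  obtain ⟨p, hp⟩ := exists_isRegMin M R hα x y hμ
  have h := mul_norm_sub_le_of_field_eq_zero (hasFDerivAt_gradObjective M R x)
    (hasFDerivAt_gradObjective M R y) (inner_hessObjective_nonneg M R x)
    (inner_hessObjective_nonneg M R y) hμ (field_eq_zero_of_isRegMin M R x y hp) hq
  rw [sub_self, abs_zero, zero_mul] at h
  have : q = p := sub_eq_zero.1 (norm_eq_zero.1 (le_antisymm (by nlinarith) (norm_nonneg _)))
  rwa [this]

theorem mul_norm_sub_le_of_isRegMin (x y : Doc D T) {s μ : ℝ} (hs : s ∈ Icc (0 : ℝ) 1)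
    {p q : Vec d} (hp : IsRegMin α (interp M R x y μ) p) (hq : IsRegMin α (interp M R x y s) q) :
    α * ‖q - p‖ ≤ |s - μ| * ‖gradObjective M R y p - gradObjective M R x p‖ :=
  mul_norm_sub_le_of_field_eq_zero (hasFDerivAt_gradObjective M R x)
    (hasFDerivAt_gradObjective M R y) (inner_hessObjective_nonneg M R x)
    (inner_hessObjective_nonneg M R y) hs (field_eq_zero_of_isRegMin M R x y hp)
    (field_eq_zero_of_isRegMin M R x y hq)

theorem existsUnique_isRegMin (hα : 0 < α) (x y : Doc D T) {μ : ℝ} (hμ : μ ∈ Icc (0 : ℝ) 1) :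
    ∃! q, IsRegMin α (interp M R x y μ) q := by
  obtain ⟨p, hp⟩ := exists_isRegMin M R hα x y hμ
  refine ⟨p, hp, fun q hq => ?_⟩
  have h := mul_norm_sub_le_of_isRegMin M R x y hμ hp hq
  rw [sub_self, abs_zero, zero_mul] at h
  exact sub_eq_zero.1 (norm_eq_zero.1 (le_antisymm (by nlinarith) (norm_nonneg _)))

theorem solvesODE_interp_iff (x y : Doc D T) (q : ℝ → Vec d) :
    SolvesODE α (interp M R x y) q ↔ ∃ q' : ℝ → Vec d, ∀ μ ∈ Icc (0 : ℝ) 1,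
      HasDerivWithinAt q (q' μ) (Icc 0 1) μ ∧
      fieldDeriv α (hessObjective M R x) (hessObjective M R y) μ (q μ) (q' μ)
        + (gradObjective M R y (q μ) - gradObjective M R x (q μ)) = 0 := by
  have hess : ∀ μ p v, fderiv ℝ (gradient (interp M R x y μ)) p v + α • v
      = fieldDeriv α (hessObjective M R x) (hessObjective M R y) μ p v := fun μ p v => by
    rw [gradient_interp, (hasFDerivAt_field (hasFDerivAt_gradObjective M R x)
      (hasFDerivAt_gradObjective M R y) μ p).fderiv]
    simp [fieldDeriv]
  have hmix : ∀ μ p, deriv (fun s => gradient (interp M R x y s) p) μ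
      = gradObjective M R y p - gradObjective M R x p := fun μ p => by
    have h1 := (((hasDerivAt_id μ).const_sub 1).smul_const (gradObjective M R x p)).add
      ((hasDerivAt_id μ).smul_const (gradObjective M R y p))
    have e : (fun s => gradient (interp M R x y s) p)
        = fun s => (1 - s) • gradObjective M R x p + s • gradObjective M R y p := by
      funext s
      simp [gradient_interp, field]
    rw [e]
    refine h1.deriv.trans ?_
    simp
    abel
  simp only [SolvesODE, hess, hmix]

theorem forall_isRegMin_iff_solvesODE (hα : 0 < α) (x y : Doc D T) (q : ℝ → Vec d) :
    (∀ μ ∈ Icc (0 : ℝ) 1, IsRegMin α (interp M R x y μ) (q μ)) ↔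
      (IsEmbedding M R α x (q 0) ∧ SolvesODE α (interp M R x y) q) := by
  have h0mem : (0 : ℝ) ∈ Icc (0 : ℝ) 1 := left_mem_Icc.2 zero_le_one
  have hx := hasFDerivAt_gradObjective M R x
  have hy := hasFDerivAt_gradObjective M R y
  rw [solvesODE_interp_iff, IsEmbedding, ← interp_zero M R x y]
  constructor
  · intro h
    have key := fun μ (hμ : μ ∈ Icc (0 : ℝ) 1) => hasDerivWithinAt_of_field_eq_zero hx hy
      (inner_hessObjective_nonneg M R x) (inner_hessObjective_nonneg M R y) hα
      (fun s hs => field_eq_zero_of_isRegMin M R x y (h s hs)) hμ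
    choose! q' hq' using key
    exact ⟨h 0 h0mem, q', hq'⟩
  · rintro ⟨h0, q', hq'⟩ μ hμ
    rw [isRegMin_iff_field_eq_zero M R hα x y hμ]
    exact field_eq_zero_of_hasDerivWithinAt hx hy (fun s hs => (hq' s hs).1)
      (fun s hs => (hq' s hs).2) (field_eq_zero_of_isRegMin M R x y h0) hμ

end Minimizers

end Objective

section Bounds

variable {d D ν T : ℕ}

/-! ### The size of the context -/

theorem norm_toEuclideanLin_single {ι : Type*} [Fintype ι] [DecidableEq ι]
    (P : Matrix (Fin d) ι ℝ) (j : ι) :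
    Matrix.toEuclideanLin P (EuclideanSpace.single j 1)
      = (WithLp.toLp 2 (fun i => P i j) : Vec d) := by
  ext i
  simp [Matrix.toLpLin_apply, Matrix.mulVec_single]

theorem norm_column_le {ι : Type*} [Finite ι] (P : Matrix (Fin d) ι ℝ) (j : ι) :
    ‖(WithLp.toLp 2 (fun i => P i j) : Vec d)‖
      ≤ ⨆ j, ‖(WithLp.toLp 2 (fun i => P i j) : Vec d)‖ :=
  le_ciSup (f := fun j => ‖(WithLp.toLp 2 (fun i => P i j) : Vec d)‖)
    (Set.finite_range _).bddAbove j

theorem concatContext_eq_sum (x : Doc D T) (i : Fin (T - (2 * ν + 1))) :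
    concatContext ν x i
      = ∑ k : Fin (2 * ν), EuclideanSpace.single (k, x (neighbor i k)) (1 : ℝ) := by
  ext ⟨k, j⟩
  simp [concatContext, Pi.single_apply, Prod.ext_iff, ite_and, eq_comm]

theorem maxColNorm_nonneg (M : Model d D ν) : 0 ≤ M.maxColNorm := by
  cases M with
  | mean P => exact Real.iSup_nonneg fun _ => norm_nonneg _
  | concat P => exact Real.iSup_nonneg fun _ => norm_nonneg _
  | bow => exact le_rfl

theorem norm_context_le (hν : 1 ≤ ν) (M : Model d D ν) (x : Doc D T)
    (i : Fin (T - (2 * ν + 1))) : ‖M.context x i‖ ≤ 2 * ν * M.maxColNorm := by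
  have hν' : (1 : ℝ) ≤ ν := by exact_mod_cast hν
  have hM := maxColNorm_nonneg M
  cases M with
  | mean P =>
    simp only [Model.context, meanContext, map_smul, map_sum, norm_toEuclideanLin_single,
      norm_smul]
    set m := (Model.mean P : Model d D ν).maxColNorm with hm
    have h : ‖∑ k : Fin (2 * ν), (WithLp.toLp 2 (fun a => P a (x (neighbor i k))) : Vec d)‖
        ≤ 2 * ν * m := by
      refine (norm_sum_le _ _).trans ((Finset.sum_le_sum fun k _ => norm_column_le P _).trans ?_)
      simp [hm, Model.maxColNorm]
    -- The factor `1/(2ν)` is discarded, which gives one bound valid for all models.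
    refine (mul_le_of_le_one_left (norm_nonneg _) ?_).trans h
    rw [Real.norm_of_nonneg (by positivity), div_le_one (by positivity)]
    linarith
  | concat P =>
    simp only [Model.context, concatContext_eq_sum, map_sum, norm_toEuclideanLin_single]
    refine (norm_sum_le _ _).trans ((Finset.sum_le_sum fun k _ => norm_column_le P _).trans ?_)
    simp [Model.maxColNorm]
  | bow => simpa [Model.context] using by positivity

theorem constPi_nonneg (M : Model d D ν) (R : Matrix (Fin D) (Fin d) ℝ) : 0 ≤ constPi M R :=
  mul_nonneg (mul_nonneg (by positivity) (sigmaMax_nonneg R)) (maxColNorm_nonneg M)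

theorem norm_logits_le (hν : 1 ≤ ν) (M : Model d D ν) (R : Matrix (Fin D) (Fin d) ℝ)
    (x : Doc D T) (i : Fin (T - (2 * ν + 1))) (q : Vec d) :
    ‖logits M R x i q‖ ≤ constPi M R + sigmaMax R * ‖q‖ := by
  refine (norm_linR_le R _).trans ?_
  have h := (norm_add_le (M.context x i) q).trans
    (add_le_add_left (norm_context_le hν M x i) ‖q‖)
  refine (mul_le_mul_of_nonneg_left h (sigmaMax_nonneg R)).trans_eq ?_
  rw [constPi]; ring

/-! ### Local strong convexity -/

theorem sum_linR_eq_zero {R : Matrix (Fin D) (Fin d) ℝ}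
    (hR : LinearMap.range (Matrix.toEuclideanLin R) ≤ (Submodule.span ℝ {ones D})ᗮ) (v : Vec d) :
    ∑ j, linR R v j = 0 := by
  have h := (Submodule.mem_orthogonal _ _).1 (hR (LinearMap.mem_range_self _ v)) _
    (Submodule.mem_span_singleton_self (ones D))
  rw [PiLp.inner_apply] at h
  simpa [ones, linR] using h

theorem le_inner_hessObjective [Nonempty (Fin D)] (hν : 1 ≤ ν) (M : Model d D ν)
    {R : Matrix (Fin D) (Fin d) ℝ} (hσ : 0 ≤ sigmaMin R)
    (hR : LinearMap.range (Matrix.toEuclideanLin R) ≤ (Submodule.span ℝ {ones D})ᗮ)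
    (x : Doc D T) {q : Vec d} {r : ℝ} (hq : ‖q‖ ≤ r) (v : Vec d) :
    ((T - (2 * ν + 1) : ℕ) : ℝ) / T *
      (Real.exp (-(√2 * (constPi M R + sigmaMax R * r))) / D * sigmaMin R ^ 2) * ‖v‖ ^ 2
      ≤ ⟪hessObjective M R x q v, v⟫ := by
  have hterm : ∀ i : Fin (T - (2 * ν + 1)),
      Real.exp (-(√2 * (constPi M R + sigmaMax R * r))) / D * (sigmaMin R ^ 2 * ‖v‖ ^ 2)
        ≤ ⟪softmaxDeriv (logits M R x i q) (linR R v), linR R v⟫ := by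
    intro i
    refine le_trans ?_ (le_inner_softmaxDeriv _ (sum_linR_eq_zero hR v))
    have h1 : ‖logits M R x i q‖ ≤ constPi M R + sigmaMax R * r :=
      (norm_logits_le hν M R x i q).trans
        (add_le_add_right (mul_le_mul_of_nonneg_left hq (sigmaMax_nonneg R)) _)
    have h2 : sigmaMin R ^ 2 * ‖v‖ ^ 2 ≤ ‖linR R v‖ ^ 2 := by
      rw [← mul_pow]
      exact pow_le_pow_left₀ (mul_nonneg hσ (norm_nonneg v)) (sigmaMin_mul_norm_le R v) 2
    gcongr
  rw [inner_hessObjective]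
  refine le_trans (le_of_eq ?_) (mul_le_mul_of_nonneg_left
    (Finset.sum_le_sum fun i _ => hterm i) (by positivity))
  simp
  ring

/-! ### Perturbation of the gradient -/

/-- The `k`-th position in the window around the predicted position number `i`. -/
def window (i : Fin (T - (2 * ν + 1))) (k : Fin (2 * ν + 1)) : Fin T :=
  ⟨i + k, by have := i.isLt; have := k.isLt; omega⟩

/-- For each offset `k` the map `i ↦ window i k` is injective, so it meets `S` at most `|S|` times;
there are `2ν + 1` offsets. -/
theorem card_window_mem_le (S : Finset (Fin T)) :
    (Finset.univ.filter fun i : Fin (T - (2 * ν + 1)) => ∃ k, window i k ∈ S).card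
      ≤ (2 * ν + 1) * S.card := by
  have hsub : (Finset.univ.filter fun i : Fin (T - (2 * ν + 1)) => ∃ k, window i k ∈ S) ⊆
      Finset.univ.biUnion fun k : Fin (2 * ν + 1) =>
        Finset.univ.filter fun i : Fin (T - (2 * ν + 1)) => window i k ∈ S := by
    intro i hi
    simpa using hi
  refine (Finset.card_le_card hsub).trans (Finset.card_biUnion_le.trans ?_)
  refine (Finset.sum_le_card_nsmul _ _ S.card fun k _ => ?_).trans_eq (by simp)
  refine Finset.card_le_card_of_injOn (fun i => window i k) (fun i hi => by simpa using hi) ?_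
  intro i _ j _ hij
  have := congrArg Fin.val hij
  simp only [window] at this
  exact Fin.ext (by omega)

theorem Model.context_congr (M : Model d D ν) {x y : Doc D T} {i : Fin (T - (2 * ν + 1))}
    (h : ∀ k, x (neighbor i k) = y (neighbor i k)) : M.context x i = M.context y i := by
  cases M with
  | mean P => simp only [Model.context, meanContext, h]
  | concat P => simp only [Model.context, concatContext, h]
  | bow => rfl

theorem eq_of_window_notMem {x y : Doc D T} {S : Finset (Fin T)} (hy : y ∈ ball x S)
    {i : Fin (T - (2 * ν + 1))} (hi : ∀ k, window i k ∉ S) :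
    x (center ν i) = y (center ν i) ∧ ∀ k, x (neighbor i k) = y (neighbor i k) := by
  refine ⟨hy _ (hi ⟨ν, by omega⟩), fun k => hy _ ?_⟩
  unfold neighbor
  split_ifs with hk
  · exact hi ⟨k, by omega⟩
  · exact hi ⟨k + 1, by omega⟩

theorem norm_gradObjective_sub_le [Nonempty (Fin D)] (hν : 1 ≤ ν) (M : Model d D ν)
    (R : Matrix (Fin D) (Fin d) ℝ) {x y : Doc D T} {S : Finset (Fin T)} (hy : y ∈ ball x S)
    (q : Vec d) :
    ‖gradObjective M R y q - gradObjective M R x q‖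
      ≤ 6 * √2 * ν * sigmaMax R * ((S.card : ℝ) / T) := by
  classical
  set a := fun (z : Doc D T) (i : Fin (T - (2 * ν + 1))) =>
    (linR R).adjoint (softmax (logits M R z i q) - EuclideanSpace.single (z (center ν i)) 1)
    with ha
  have hnorm : ∀ z i, ‖a z i‖ ≤ sigmaMax R * √2 := fun z i =>
    (norm_adjoint_linR_le R _).trans
      (mul_le_mul_of_nonneg_left (norm_softmax_sub_single_le _ _) (sigmaMax_nonneg R))
  have hterm : ∀ i, ‖a y i - a x i‖
      ≤ if ∃ k, window i k ∈ S then 2 * √2 * sigmaMax R else 0 := by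
    intro i
    split_ifs with h
    · refine (norm_sub_le _ _).trans ((add_le_add (hnorm y i) (hnorm x i)).trans_eq ?_)
      ring
    · push Not at h
      obtain ⟨hc, hn⟩ := eq_of_window_notMem hy h
      have : a y i = a x i := by
        simp only [ha, logits, M.context_congr hn, hc]
      rw [this, sub_self, norm_zero]
  have hcard : ((Finset.univ.filter fun i : Fin (T - (2 * ν + 1)) => ∃ k, window i k ∈ S).card : ℝ)
      ≤ 3 * ν * S.card := by
    have h1 : (2 * ν + 1) * S.card ≤ 3 * ν * S.card := Nat.mul_le_mul_right _ (by omega)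
    exact_mod_cast (card_window_mem_le S).trans h1
  have hsum : ‖∑ i, a y i - ∑ i, a x i‖ ≤ 3 * ν * S.card * (2 * √2 * sigmaMax R) := by
    rw [← Finset.sum_sub_distrib]
    refine (norm_sum_le _ _).trans ((Finset.sum_le_sum fun i _ => hterm i).trans ?_)
    rw [← Finset.sum_filter, Finset.sum_const, nsmul_eq_mul]
    exact mul_le_mul_of_nonneg_right hcard
      (mul_nonneg (by positivity) (sigmaMax_nonneg R))
  have e : gradObjective M R y q - gradObjective M R x q
      = (1 / (T : ℝ)) • (∑ i, a y i - ∑ i, a x i) := (smul_sub _ _ _).symm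
  rw [e, norm_smul, Real.norm_of_nonneg (by positivity)]
  refine (mul_le_mul_of_nonneg_left hsum (by positivity)).trans_eq ?_
  ring

theorem norm_gradObjective_le [Nonempty (Fin D)] (M : Model d D ν)
    (R : Matrix (Fin D) (Fin d) ℝ) (x : Doc D T) (q : Vec d) :
    ‖gradObjective M R x q‖ ≤ √2 * sigmaMax R := by
  rw [gradObjective, norm_smul, Real.norm_of_nonneg (by positivity)]
  have h0 : 0 ≤ √2 * sigmaMax R := mul_nonneg (by positivity) (sigmaMax_nonneg R)
  have h : ‖∑ i : Fin (T - (2 * ν + 1)), (linR R).adjoint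
      (softmax (logits M R x i q) - EuclideanSpace.single (x (center ν i)) 1)‖
      ≤ T * (√2 * sigmaMax R) := by
    refine (norm_sum_le_of_le _ fun i _ => (norm_adjoint_linR_le R _).trans
      (mul_le_mul_of_nonneg_left (norm_softmax_sub_single_le _ _) (sigmaMax_nonneg R))).trans ?_
    rw [Finset.sum_const, Finset.card_univ, Fintype.card_fin, nsmul_eq_mul, mul_comm (sigmaMax R)]
    exact mul_le_mul_of_nonneg_right (by exact_mod_cast Nat.sub_le _ _) h0
  refine (mul_le_mul_of_nonneg_left h (by positivity)).trans ?_
  rw [← mul_assoc, one_div]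
  exact mul_le_of_le_one_left h0 inv_mul_le_one

/-- Stationarity reads `αq = -∇F_x(q)`. This radius is the one inside the exponential of
`threshold`. -/
theorem norm_le_of_isEmbedding [Nonempty (Fin D)] (M : Model d D ν)
    (R : Matrix (Fin D) (Fin d) ℝ) {α : ℝ} (hα : 0 < α) {x : Doc D T} {q : Vec d}
    (hq : IsEmbedding M R α x q) : ‖q‖ ≤ √2 * sigmaMax R / α := by
  rw [IsEmbedding, ← interp_zero M R x x] at hq
  have h := field_eq_zero_of_isRegMin M R x x hq
  have h1 : α • q = -gradObjective M R x q := by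
    rw [eq_neg_iff_add_eq_zero, ← h]
    simp [field, add_comm]
  have h2 := congrArg norm h1
  rw [norm_neg, norm_smul, Real.norm_of_nonneg hα.le] at h2
  rw [le_div_iff₀ hα, mul_comm, h2]
  exact norm_gradObjective_le M R x q

end Bounds

/-! ### Positivity and size of the constants -/

section Constants

variable {d D ν T : ℕ}

/-- With at most one token, zero coordinate sum forces `R = 0`, against `σ_min > 0`. -/
theorem two_le_of_sigmaMin_pos (hd : 1 ≤ d) {R : Matrix (Fin D) (Fin d) ℝ} (hσ : 0 < sigmaMin R)
    (hR : LinearMap.range (Matrix.toEuclideanLin R) ≤ (Submodule.span ℝ {ones D})ᗮ) : 2 ≤ D := by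
  by_contra! hD
  have := Fin.subsingleton_iff_le_one.2 (Nat.le_of_lt_succ hD)
  set v : Vec d := EuclideanSpace.single ⟨0, hd⟩ 1 with hv
  have h0 : linR R v = 0 := by
    ext j
    have h := sum_linR_eq_zero hR v
    rwa [Fintype.sum_subsingleton _ j] at h
  have h1 := sigmaMin_mul_norm_le R v
  rw [h0, norm_zero] at h1
  simp [hv] at h1
  linarith

variable (M : Model d D ν) (R : Matrix (Fin D) (Fin d) ℝ)

theorem constC_nonneg : 0 ≤ constC R := mul_nonneg (by positivity) (sigmaMax_nonneg R)

variable {R}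

theorem constA_pos (hν : 1 ≤ ν) (hD : 2 ≤ D) (hσ : 0 < sigmaMin R) : 0 < constA M R := by
  have hs := hσ.trans_le (sigmaMin_le_sigmaMax R)
  have hν' : (0 : ℝ) < ν := by exact_mod_cast hν
  have hD' : (0 : ℝ) < D := by exact_mod_cast (by omega : 0 < D)
  unfold constA ell
  positivity

theorem lipConst_pos (hν : 1 ≤ ν) (hD : 2 ≤ D) (hσ : 0 < sigmaMin R) (r : ℝ) :
    0 < lipConst M R r :=
  mul_pos (mul_pos two_pos (constA_pos M hν hD hσ)) (Real.exp_pos _)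

/-- `384 = 64 · 3 · 2` from `ℓ = 3` and `D ≥ 2`; the other factors are at least `1`. The only role
of `B` is to make the threshold small compared with `1/ν`. -/
theorem le_constB (hD : 2 ≤ D) (hσ : 0 < sigmaMin R) : 384 * (ν : ℝ) ≤ constB M R := by
  have hD' : (2 : ℝ) ≤ D := by exact_mod_cast hD
  have hPi := constPi_nonneg M R
  have h1 : 1 ≤ sigmaMax R ^ 2 / sigmaMin R ^ 2 := by
    rw [one_le_div (by positivity)]
    exact pow_le_pow_left₀ hσ.le (sigmaMin_le_sigmaMax R) 2
  have h2 : 1 ≤ Real.exp (10 * √2 * constPi M R) := Real.one_le_exp (by positivity)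
  have h3 : 1 ≤ sigmaMax R ^ 2 / sigmaMin R ^ 2 + constPi M R / ((D : ℝ) - 1) :=
    h1.trans (le_add_of_nonneg_right (div_nonneg hPi (by linarith)))
  have h4 : 384 * (ν : ℝ) ≤ 64 * ell * (ν : ℝ) * (D : ℝ) := by
    unfold ell
    nlinarith [mul_le_mul_of_nonneg_left hD' (Nat.cast_nonneg (α := ℝ) ν)]
  have h5 : 0 ≤ 64 * ell * (ν : ℝ) * (D : ℝ) := le_trans (by positivity) h4
  calc 384 * (ν : ℝ) ≤ 64 * ell * (ν : ℝ) * (D : ℝ) * 1 * 1 * 1 := by simpa using h4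
    _ ≤ constB M R := by
      unfold constB
      gcongr

theorem constB_pos (hν : 1 ≤ ν) (hD : 2 ≤ D) (hσ : 0 < sigmaMin R) : 0 < constB M R :=
  lt_of_lt_of_le (by have : (1 : ℝ) ≤ ν := by exact_mod_cast hν
                     positivity) (le_constB M hD hσ)

theorem threshold_pos (hν : 1 ≤ ν) (hD : 2 ≤ D) (hσ : 0 < sigmaMin R) (α : ℝ) :
    0 < threshold M R α := by
  have := constB_pos M hν hD hσ
  unfold threshold
  positivity

theorem threshold_mul_le_one (hν : 1 ≤ ν) (hD : 2 ≤ D) (hσ : 0 < sigmaMin R) (α : ℝ) :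
    threshold M R α * (768 * ν) ≤ 1 := by
  have hB := constB_pos M hν hD hσ
  have hA := constA_pos M hν hD hσ
  have hC := constC_nonneg R
  have h1 : threshold M R α ≤ 1 / (2 * constB M R) := by
    refine mul_le_of_le_one_right (by positivity) (Real.exp_le_one_iff.2 ?_)
    have : 0 ≤ 2 * (constA M R * constC R + 1) *
      Real.exp (constC R * (√2 * sigmaMax R / α)) := by positivity
    linarith
  calc threshold M R α * (768 * ν) ≤ 1 / (2 * constB M R) * (2 * constB M R) := by
        refine mul_le_mul h1 ?_ (by positivity) (by positivity)
        linarith [le_constB M hD hσ]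
    _ = 1 := by field_simp

theorem constC_mul_lipConst_mul_threshold_le (hν : 1 ≤ ν) (hD : 2 ≤ D) (hσ : 0 < sigmaMin R)
    {α r : ℝ} (hr : r ≤ √2 * sigmaMax R / α) :
    constC R * lipConst M R r * threshold M R α ≤ 1 := by
  have hB := constB_pos M hν hD hσ
  have hB1 : 1 ≤ constB M R := by
    have h1 : (1 : ℝ) ≤ ν := by exact_mod_cast hν
    linarith [le_constB M hD hσ]
  have hA := constA_pos M hν hD hσ
  have hC := constC_nonneg R
  -- The exponential in the threshold is `e^{-2w}`, while `C L(r) ≤ 2w`; the product is controlled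
  -- by `2w e^{-2w} ≤ 1`.
  set w := (constA M R * constC R + 1) * Real.exp (constC R * (√2 * sigmaMax R / α)) with hw
  have hw0 : 0 ≤ w := by positivity
  have h1 : constC R * lipConst M R r ≤ 2 * w := by
    have : constC R * lipConst M R r
        = 2 * ((constA M R * constC R) * Real.exp (constC R * r)) := by unfold lipConst; ring
    rw [this, hw]
    gcongr
    linarith
  have h2 : 2 * w * Real.exp (-(2 * w)) ≤ 1 := by
    rw [Real.exp_neg, ← div_eq_mul_inv, div_le_one (Real.exp_pos _)]
    linarith [Real.add_one_le_exp (2 * w)]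
  have h3 : threshold M R α = 1 / (2 * constB M R) * Real.exp (-(2 * w)) := by
    rw [threshold, hw]
    congr 2
    ring
  have h4 : 1 / (2 * constB M R) ≤ 1 := by
    rw [div_le_one (by positivity)]
    linarith
  calc constC R * lipConst M R r * threshold M R α
      ≤ 2 * w * (1 / (2 * constB M R) * Real.exp (-(2 * w))) := by
        rw [← h3]
        exact mul_le_mul_of_nonneg_right h1 (threshold_pos M hν hD hσ α).le
    _ = 1 / (2 * constB M R) * (2 * w * Real.exp (-(2 * w))) := by ring
    _ ≤ 1 * 1 := mul_le_mul h4 h2 (by positivity) zero_le_one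
    _ = 1 := one_mul 1

/-! ### Bounded trajectories -/

/-- A nonempty `S` below the threshold forces `T ≥ 768ν`, so the excluded boundary positions are
few. -/
theorem three_quarters_le_card_predicted_div (hν : 1 ≤ ν) (hD : 2 ≤ D) (hσ : 0 < sigmaMin R)
    {α : ℝ} {S : Finset (Fin T)} (hS : S.Nonempty)
    (hc : (S.card : ℝ) / T ≤ threshold M R α) :
    3 / 4 ≤ ((T - (2 * ν + 1) : ℕ) : ℝ) / T := by
  obtain ⟨i, -⟩ := id hS
  have hT : (0 : ℝ) < T := by exact_mod_cast i.pos
  have hS1 : (1 : ℝ) ≤ S.card := by exact_mod_cast hS.card_pos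
  have hν' : (1 : ℝ) ≤ ν := by exact_mod_cast hν
  rw [div_le_iff₀ hT] at hc
  have h1 : 768 * (ν : ℝ) ≤ T := by
    have h := mul_le_mul_of_nonneg_right (threshold_mul_le_one M hν hD hσ α) hT.le
    nlinarith [mul_le_mul_of_nonneg_left (hS1.trans hc) (by positivity : (0 : ℝ) ≤ 768 * ν)]
  have h2 : 2 * ν + 1 ≤ T := by
    have : (768 * ν : ℕ) ≤ T := by exact_mod_cast h1
    omega
  rw [le_div_iff₀ hT, Nat.cast_sub h2]
  push_cast
  linarith

theorem norm_sub_le_lipConst_mul [Nonempty (Fin D)] (hν : 1 ≤ ν) (hD : 2 ≤ D)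
    (hσ : 0 < sigmaMin R)
    (hR : LinearMap.range (Matrix.toEuclideanLin R) ≤ (Submodule.span ℝ {ones D})ᗮ)
    {α : ℝ} (hα : 0 < α) {x y : Doc D T} {S : Finset (Fin T)} (hy : y ∈ ball x S)
    (hc : (S.card : ℝ) / T ≤ threshold M R α) {μ : ℝ} (hμ : μ ∈ Icc (0 : ℝ) 1) {p q : Vec d}
    (hp : IsEmbedding M R α x p) (hq : IsRegMin α (interp M R x y μ) q) :
    ‖q - p‖ ≤ lipConst M R ‖p‖ * ((S.card : ℝ) / T) := by
  have hp0 := hp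
  rw [IsEmbedding, ← interp_zero M R x y] at hp0
  have hgrad := norm_gradObjective_sub_le hν M R hy p
  have hL := lipConst_pos M hν hD hσ ‖p‖
  set ρ := lipConst M R ‖p‖ * ((S.card : ℝ) / T) with hρ
  have hρ0 : 0 ≤ ρ := by positivity
  -- For `S = ∅` the radius is `0` and the strict inequality of the ball argument fails; there the
  -- gradients coincide and `q = p`.
  rcases S.eq_empty_or_nonempty with rfl | hS
  · have h := mul_norm_sub_le_of_isRegMin M R x y hμ hp0 hq
    simp only [Finset.card_empty, Nat.cast_zero, zero_div, mul_zero] at hgrad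
    have h2 : α * ‖q - p‖ ≤ 0 :=
      h.trans (mul_nonpos_of_nonneg_of_nonpos (abs_nonneg _) hgrad)
    exact (nonpos_of_mul_nonpos_right h2 hα).trans hρ0
  have hfrac := three_quarters_le_card_predicted_div M hν hD hσ hS hc
  have hs := hσ.trans_le (sigmaMin_le_sigmaMax R)
  have hPi := constPi_nonneg M R
  have hν0 : (0 : ℝ) < ν := by exact_mod_cast hν
  have hD0 : (0 : ℝ) < D := by exact_mod_cast (by omega : 0 < D)
  have hε : 0 < (S.card : ℝ) / T := by
    obtain ⟨i, -⟩ := id hS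
    have hT : (0 : ℝ) < T := by exact_mod_cast i.pos
    have hS1 : (0 : ℝ) < S.card := by exact_mod_cast hS.card_pos
    positivity
  have hsmall : √2 * sigmaMax R * ρ ≤ 1 / 5 := by
    have h1 := constC_mul_lipConst_mul_threshold_le M hν hD hσ (norm_le_of_isEmbedding M R hα hp)
    have h2 : constC R * ρ ≤ constC R * lipConst M R ‖p‖ * threshold M R α := by
      rw [hρ, ← mul_assoc]
      exact mul_le_mul_of_nonneg_left hc (mul_nonneg (constC_nonneg R) hL.le)
    have h3 : constC R * ρ = 5 * (√2 * sigmaMax R * ρ) := by unfold constC; ring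
    linarith
  refine norm_sub_le_of_field_eq_zero (hasFDerivAt_gradObjective M R x)
    (hasFDerivAt_gradObjective M R y) (inner_hessObjective_nonneg M R x)
    (inner_hessObjective_nonneg M R y) hα
    (k := ((T - (2 * ν + 1) : ℕ) : ℝ) / T *
      (Real.exp (-(√2 * (constPi M R + sigmaMax R * (‖p‖ + ρ)))) / D * sigmaMin R ^ 2))
    hμ hρ0 (fun z hz v => ?_) (fun z hz v => ?_)
    (field_eq_zero_of_isRegMin M R x y hp0) (field_eq_zero_of_isRegMin M R x y hq)
    (hgrad.trans_lt ?_)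
  · exact le_inner_hessObjective hν M hσ.le hR x
      (by linarith [norm_sub_norm_le z p]) v
  · exact le_inner_hessObjective hν M hσ.le hR y
      (by linarith [norm_sub_norm_le z p]) v
  -- The exponentials in `L` overcompensate those in the convexity modulus for `Π` and `‖p‖`. Only
  -- `-√2 σ_max ρ ≥ -1/5` remains, and `e^t ≥ 1 + t`.
  have hexp : (4 : ℝ) / 5 ≤ Real.exp (-(√2 * (constPi M R + sigmaMax R * (‖p‖ + ρ)))) *
      Real.exp (2 * √2 * constPi M R) * Real.exp (constC R * ‖p‖) := by
    rw [← Real.exp_add, ← Real.exp_add]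
    refine le_trans ?_ (Real.add_one_le_exp _)
    have e : -(√2 * (constPi M R + sigmaMax R * (‖p‖ + ρ))) + 2 * √2 * constPi M R
        + constC R * ‖p‖
        = √2 * constPi M R + 4 * (√2 * sigmaMax R * ‖p‖) - √2 * sigmaMax R * ρ := by
      unfold constC; ring
    have h1 : 0 ≤ √2 * constPi M R := by positivity
    have h2 : 0 ≤ √2 * sigmaMax R * ‖p‖ := by positivity
    rw [e]
    linarith
  have hsqrt : √2 < 3 / 2 := by
    rw [Real.sqrt_lt' (by norm_num)]
    norm_num
  set ε := (S.card : ℝ) / T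
  -- Here `24 = 2 · 4ℓ` comes from `L = 2A e^{Cr}`; `D` and `σ_min²` cancel against the modulus.
  -- Numerically `6√2 < 9 < 14.4`.
  calc 6 * √2 * ν * sigmaMax R * ε = 6 * √2 * (ν * sigmaMax R * ε) := by ring
    _ < 3 / 4 * (4 / 5) * 24 * (ν * sigmaMax R * ε) :=
      mul_lt_mul_of_pos_right (by linarith) (by positivity)
    _ ≤ ((T - (2 * ν + 1) : ℕ) : ℝ) / T *
        (Real.exp (-(√2 * (constPi M R + sigmaMax R * (‖p‖ + ρ)))) *
          Real.exp (2 * √2 * constPi M R) * Real.exp (constC R * ‖p‖)) * 24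
        * (ν * sigmaMax R * ε) := by gcongr
    _ = _ := by
      rw [hρ, lipConst, constA, ell]
      field_simp
      ring

theorem mem_ball_filter_ne (x y : Doc D T) : y ∈ ball x (Finset.univ.filter fun i => x i ≠ y i) :=
  fun i hi => by simpa using hi

end Constants

end Doc2Vec

end

theorem theorem1 {d D ν : ℕ} (hd : 1 ≤ d) (hν : 1 ≤ ν)
    (M : Doc2Vec.Model d D ν) (R : Matrix (Fin D) (Fin d) ℝ) (α : ℝ) (hα : 0 < α)
    (hσ : 0 < Doc2Vec.sigmaMin R)
    (hR : LinearMap.range (Matrix.toEuclideanLin R) ≤ (Submodule.span ℝ {Doc2Vec.ones D})ᗮ) :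
    -- the constants `c(α)` and `L(r)` are positive
    (0 < Doc2Vec.threshold M R α ∧ ∀ r : ℝ, 0 < Doc2Vec.lipConst M R r) ∧
    -- the interpolated regularized problems have unique minimizers
    (∀ (T : ℕ) (x y : Doc2Vec.Doc D T), ∀ μ ∈ Set.Icc (0 : ℝ) 1,
      ∃! q, Doc2Vec.IsRegMin α (Doc2Vec.interp M R x y μ) q) ∧
    -- the trajectory of minimizers is the unique solution of the ODE that starts at
    -- the embedding of `x`
    (∀ (T : ℕ) (x y : Doc2Vec.Doc D T) (q : ℝ → Doc2Vec.Vec d),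
      (∀ μ ∈ Set.Icc (0 : ℝ) 1, Doc2Vec.IsRegMin α (Doc2Vec.interp M R x y μ) (q μ)) ↔
        (Doc2Vec.IsEmbedding M R α x (q 0) ∧
          Doc2Vec.SolvesODE α (Doc2Vec.interp M R x y) q)) ∧
    -- bounded trajectories
    (∀ (T : ℕ) (x : Doc2Vec.Doc D T) (S : Finset (Fin T)), ∀ y ∈ Doc2Vec.ball x S,
      (S.card : ℝ) / (T : ℝ) ≤ Doc2Vec.threshold M R α →
      ∀ q : ℝ → Doc2Vec.Vec d,
        (∀ μ ∈ Set.Icc (0 : ℝ) 1, Doc2Vec.IsRegMin α (Doc2Vec.interp M R x y μ) (q μ)) →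
        ∀ μ ∈ Set.Icc (0 : ℝ) 1,
          ‖q μ - q 0‖ ≤ Doc2Vec.lipConst M R ‖q 0‖ * ((S.card : ℝ) / (T : ℝ))) ∧
    -- Lipschitz continuity of the embedding, with the same explicit constants
    (∀ (T : ℕ) (x y : Doc2Vec.Doc D T) (p q : Doc2Vec.Vec d),
      Doc2Vec.IsEmbedding M R α x p → Doc2Vec.IsEmbedding M R α y q →
      (hammingDist x y : ℝ) / (T : ℝ) ≤ Doc2Vec.threshold M R α →
      ‖p - q‖ ≤ Doc2Vec.lipConst M R ‖p‖ / (T : ℝ) * (hammingDist x y : ℝ)) ∧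
    -- and for all pairs of documents of the same length `T`, with a constant proportional to `1/T`
    (∃ K : ℝ, ∀ (T : ℕ) (x y : Doc2Vec.Doc D T) (p q : Doc2Vec.Vec d),
      Doc2Vec.IsEmbedding M R α x p → Doc2Vec.IsEmbedding M R α y q →
      ‖p - q‖ ≤ K / (T : ℝ) * (hammingDist x y : ℝ)) := by
  have hD := Doc2Vec.two_le_of_sigmaMin_pos hd hσ hR
  have : Nonempty (Fin D) := ⟨⟨0, by omega⟩⟩
  have h0mem : (0 : ℝ) ∈ Set.Icc (0 : ℝ) 1 := Set.left_mem_Icc.2 zero_le_one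
  have h1mem : (1 : ℝ) ∈ Set.Icc (0 : ℝ) 1 := Set.right_mem_Icc.2 zero_le_one
  refine ⟨⟨Doc2Vec.threshold_pos M hν hD hσ α, Doc2Vec.lipConst_pos M hν hD hσ⟩,
    fun T x y μ hμ => Doc2Vec.existsUnique_isRegMin M R hα x y hμ,
    fun T x y q => Doc2Vec.forall_isRegMin_iff_solvesODE M R hα x y q,
    fun T x S y hy hc q hq μ hμ => ?_, fun T x y p q hp hq hc => ?_,
    -- The witness `K` is the gradient perturbation constant divided by the modulus `α`, which is
    -- valid at any distance.
    6 * √2 * ν * Doc2Vec.sigmaMax R / α, fun T x y p q hp hq => ?_⟩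
  · refine Doc2Vec.norm_sub_le_lipConst_mul M hν hD hσ hR hα hy hc hμ ?_ (hq μ hμ)
    rw [Doc2Vec.IsEmbedding, ← Doc2Vec.interp_zero M R x y]
    exact hq 0 h0mem
  · rw [Doc2Vec.IsEmbedding, ← Doc2Vec.interp_one M R x y] at hq
    -- The trajectory bound at `μ = 1`, with `S` the set of positions where `x` and `y` differ.
    have h := Doc2Vec.norm_sub_le_lipConst_mul M hν hD hσ hR hα
      (Doc2Vec.mem_ball_filter_ne x y) hc h1mem hp hq
    rw [norm_sub_rev]
    refine h.trans_eq ?_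
    rw [hammingDist]
    ring
  · rw [Doc2Vec.IsEmbedding, ← Doc2Vec.interp_one M R x y] at hq
    rw [Doc2Vec.IsEmbedding, ← Doc2Vec.interp_zero M R x y] at hp
    have h := Doc2Vec.mul_norm_sub_le_of_isRegMin M R x y h1mem hp hq
    rw [sub_zero, abs_one, one_mul] at h
    have h2 := h.trans (Doc2Vec.norm_gradObjective_sub_le hν M R
      (Doc2Vec.mem_ball_filter_ne x y) p)
    rw [← le_div_iff₀' hα] at h2
    rw [norm_sub_rev]
    refine h2.trans_eq ?_
    rw [hammingDist]
    ring
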